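/- For a group $G$ and an abelian group $M$ with trivial $G$-action, $\mathrm{H}^2(G,M)$ denotes the group of $2$-cocycles $\alpha:G\times G\to M$, i.e. maps with $\alpha(g,h)\alpha(gh,k)=\alpha(h,k)\alpha(g,hk)$, modulo the coboundaries $(g,h)\mapsto f(g)f(h)f(gh)^{-1}$ with $f:G\to M$. For a $2$-cocycle $\alpha:G\times G\to\mathbb{C}^\times$, the twisted group algebra $\mathbb{C}^\alpha G$ is the $\mathbb{C}$-vector space with basis $\{\bar g : g\in G\}$ and bilinear multiplication $\bar g\,\bar h=\alpha(g,h)\,\overline{gh}$; up to isomorphism of $\mathbb{C}$-algebras it depends only on the class $[\alpha]$. We write $G\sim_{\mathbb{C}}H$ via $\phi$ if $\phi:\mathrm{H}^2(G,\mathbb{C}^\times)\to\mathrm{H}^2(H,\mathbb{C}^\times)$ is a group isomorphism such that $\mathbb{C}^\alpha G\cong\mathbb{C}^{\phi(\alpha)}H$ as $\mathbb{C}$-algebras for every $[\alpha]\in\mathrm{H}^2(G,\mathbb{C}^\times)$, and $G\sim_{\mathbb{C}}H$ if such a $\phi$ exists. For a central subgroup $Z$ of $G$, the inflation $\inf:\mathrm{H}^2(G/Z,\mathbb{C}^\times)\to\mathrm{H}^2(G,\mathbb{C}^\times)$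 sends $[\alpha]$ to the class of $(x,y)\mapsto\alpha(xZ,yZ)$, and the transgression $\mathrm{tra}:\mathrm{Hom}(Z,\mathbb{C}^\times)\to\mathrm{H}^2(G/Z,\mathbb{C}^\times)$ sends $\chi$ to the class of $(x,y)\mapsto\chi(\mu(x)\mu(y)\mu(xy)^{-1})$, where $\mu:G/Z\to G$ is any section of the quotient map; the class does not depend on $\mu$. **Theorem.** Let $G_1,G_2$ be finite groups and, for $j=1,2$, let $Z_j$ be a central subgroup of $G_j$, with transgression $\mathrm{tra}_j$ and inflation $\inf_j$, such that the sequence $$1\to\mathrm{Hom}(Z_j,\mathbb{C}^\times)\xrightarrow{\ \mathrm{tra}_j\ }\mathrm{H}^2(G_j/Z_j,\mathbb{C}^\times)\xrightarrow{\ \inf_j\ }\mathrm{H}^2(G_j,\mathbb{C}^\times)\to 1$$ is exact. Suppose that $G_1/Z_1\sim_{\mathbb{C}}G_2/Z_2$ via a map $\bar\phi$, and that there is a group isomorphism $\bar i:\mathrm{Hom}(Z_1,\mathbb{C}^\times)\to\mathrm{Hom}(Z_2,\mathbb{C}^\times)$ with $\bar\phi\circ\mathrm{tra}_1=\mathrm{tra}_2\circ\bar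 i$. Then $G_1\sim_{\mathbb{C}}G_2$. -/

import Mathlib

noncomputable section

namespace TGR

universe u v w

section Cohomology

/-- The group `Z²(G, M)` of `2`-cocycles of `G` with values in the abelian group `M`, on which `G`
acts trivially, written multiplicatively. -/
def Z2 (G : Type u) (M : Type v) [Group G] [CommGroup M] : Subgroup (G × G → M) where
  carrier := {α | ∀ g h k : G, α (g, h) * α (g * h, k) = α (h, k) * α (g, h * k)}
  one_mem' := fun _ _ _ => rfl
  mul_mem' := by
    intro α β hα hβ g h k
    simp only [Pi.mul_apply]
    rw [mul_mul_mul_comm, hα, hβ, mul_mul_mul_comm]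
  inv_mem' := by
    intro α hα g h k
    simp only [Pi.inv_apply]
    rw [← mul_inv, ← mul_inv, hα]

/-- The group `B²(G, M)` of `2`-coboundaries, as a subgroup of `Z²(G, M)`. -/
def B2 (G : Type u) (M : Type v) [Group G] [CommGroup M] : Subgroup (Z2 G M) where
  carrier := {α | ∃ f : G → M, ∀ g h : G, α.1 (g, h) = f g * f h * (f (g * h))⁻¹}
  one_mem' := ⟨fun _ => 1, fun _ _ => by simp⟩
  mul_mem' := by
    rintro α β ⟨f, hf⟩ ⟨f', hf'⟩
    refine ⟨f * f', fun g h => ?_⟩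
    simp only [Subgroup.coe_mul, Pi.mul_apply, hf, hf', mul_inv]
    rw [mul_mul_mul_comm, mul_mul_mul_comm (f g)]
  inv_mem' := by
    rintro α ⟨f, hf⟩
    refine ⟨f⁻¹, fun g h => ?_⟩
    simp only [Subgroup.coe_inv, Pi.inv_apply, hf, mul_inv]

/-- The second cohomology group `H²(G, M)` of `G` with coefficients in the trivial `G`-module `M`,
written multiplicatively. -/
abbrev H2 (G : Type u) (M : Type v) [Group G] [CommGroup M] : Type (max u v) :=
  Z2 G M ⧸ B2 G M

/-- The cohomology class `[α]` of a `2`-cocycle `α`. -/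
def cls {G : Type u} {M : Type v} [Group G] [CommGroup M] : Z2 G M →* H2 G M :=
  QuotientGroup.mk' (B2 G M)

theorem cls_eq_cls_iff {G : Type u} {M : Type v} [Group G] [CommGroup M] (α β : Z2 G M) :
    cls α = cls β ↔
      ∃ f : G → M, ∀ g h : G, β.1 (g, h) = α.1 (g, h) * (f g * f h * (f (g * h))⁻¹) := by
  refine QuotientGroup.eq.trans (exists_congr fun f => forall₂_congr fun g h => ?_)
  simp only [Subgroup.coe_mul, Subgroup.coe_inv, Pi.mul_apply, Pi.inv_apply]
  exact inv_mul_eq_iff_eq_mul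

/-- Inflation of cocycles: `α'(x, y) = α(xN, yN)`. -/
def infCocycle {G : Type u} [Group G] (N : Subgroup G) [N.Normal]
    (M : Type v) [CommGroup M] : Z2 (G ⧸ N) M →* Z2 G M where
  toFun α := ⟨fun p => α.1 ((p.1 : G ⧸ N), (p.2 : G ⧸ N)), fun g h k => α.2 g h k⟩
  map_one' := rfl
  map_mul' _ _ := rfl

/-- The inflation homomorphism `inf : H²(G/N, M) → H²(G, M)`, `[α] ↦ [α']`. -/
def inf {G : Type u} [Group G] (N : Subgroup G) [N.Normal]
    (M : Type v) [CommGroup M] : H2 (G ⧸ N) M →* H2 G M :=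
  QuotientGroup.map (B2 (G ⧸ N) M) (B2 G M) (infCocycle N M) (by
    rintro α ⟨f, hf⟩
    exact ⟨fun g => f (g : G ⧸ N), fun g h => hf g h⟩)

end Cohomology

section Transgression

variable {G : Type u} [Group G] (Z : Subgroup G) [Z.Normal]

/-- For a section `μ` of `G → G/Z`, the element `μ(x) μ(y) μ(xy)⁻¹` of `Z`. -/
def factorSet (μ : G ⧸ Z → G) (hμ : ∀ x, (μ x : G ⧸ Z) = x) (x y : G ⧸ Z) : Z :=
  ⟨μ x * μ y * (μ (x * y))⁻¹, by
    rw [← QuotientGroup.eq_one_iff]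
    simp [hμ]⟩

/-- The cocycle `α_χ(x, y) = χ(μ(x) μ(y) μ(xy)⁻¹)` of `G/Z`, for a central subgroup `Z` of `G`,
a section `μ` of `G → G/Z` and a homomorphism `χ : Z → M`; as a homomorphism in `χ`. -/
def traCocycle (hZ : Z ≤ Subgroup.center G) (M : Type v) [CommGroup M]
    (μ : G ⧸ Z → G) (hμ : ∀ x, (μ x : G ⧸ Z) = x) : (Z →* M) →* Z2 (G ⧸ Z) M where
  toFun χ := ⟨fun p => χ (factorSet Z μ hμ p.1 p.2), by
    intro x y z
    simp only [← map_mul]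
    congr 1
    apply Subtype.ext
    have hc := Subgroup.mem_center_iff.1 (hZ (factorSet Z μ hμ y z).2) (μ x)
    simp only [factorSet, Subgroup.coe_mul] at hc ⊢
    rw [mul_assoc x y z]
    calc μ x * μ y * (μ (x * y))⁻¹ * (μ (x * y) * μ z * (μ (x * (y * z)))⁻¹)
        = μ x * (μ y * μ z * (μ (y * z))⁻¹) * (μ (y * z) * (μ (x * (y * z)))⁻¹) := by group
      _ = _ := by rw [hc]; group⟩
  map_one' := rfl
  map_mul' _ _ := rfl

/-- The class of `α_χ` does not depend on the section. -/
theorem cls_traCocycle_eq (hZ : Z ≤ Subgroup.center G) (M : Type v) [CommGroup M]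
    (μ ν : G ⧸ Z → G) (hμ : ∀ x, (μ x : G ⧸ Z) = x) (hν : ∀ x, (ν x : G ⧸ Z) = x) (χ : Z →* M) :
    cls (traCocycle Z hZ M μ hμ χ) = cls (traCocycle Z hZ M ν hν χ) := by
  have hd : ∀ x, ν x * (μ x)⁻¹ ∈ Z := fun x => by
    rw [← QuotientGroup.eq_one_iff]
    simp [hμ, hν]
  rw [cls_eq_cls_iff]
  refine ⟨fun x => χ ⟨_, hd x⟩, fun x y => ?_⟩
  change χ _ = χ _ * _
  simp only [← map_mul, ← map_inv]
  congr 1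
  apply Subtype.ext
  have hx := fun g => Subgroup.mem_center_iff.1 (hZ (hd x)) g
  have hy := fun g => Subgroup.mem_center_iff.1 (hZ (hd y)) g
  have hxy := fun g => Subgroup.mem_center_iff.1 (hZ (inv_mem (hd (x * y)))) g
  simp only [factorSet, Subgroup.coe_mul, Subgroup.coe_inv]
  generalize ha : ν x * (μ x)⁻¹ = a at *
  generalize hb : ν y * (μ y)⁻¹ = b at *
  generalize hc : ν (x * y) * (μ (x * y))⁻¹ = c at *
  rw [mul_inv_eq_iff_eq_mul] at ha hb hc
  rw [ha, hb, hc]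
  calc a * μ x * (b * μ y) * (c * μ (x * y))⁻¹
      = a * (μ x * b) * (μ y * (μ (x * y))⁻¹ * c⁻¹) := by group
    _ = a * b * ((μ x * μ y * (μ (x * y))⁻¹) * c⁻¹) := by rw [hy]; group
    _ = _ := by
      generalize μ x * μ y * (μ (x * y))⁻¹ = t
      rw [mul_assoc a b, ← mul_assoc b t, ← hy t, mul_assoc t b, ← mul_assoc a t, ← hx t,
        mul_assoc t a, ← mul_assoc a b]

/-- The transgression homomorphism `tra : Hom(Z, M) → H²(G/Z, M)`, `χ ↦ [α_χ]`, of the central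
extension `1 → Z → G → G/Z → 1`. -/
def tra (hZ : Z ≤ Subgroup.center G) (M : Type v) [CommGroup M] : (Z →* M) →* H2 (G ⧸ Z) M :=
  cls.comp (traCocycle Z hZ M Quotient.out fun x => QuotientGroup.out_eq' x)

/-- The transgression may be computed with any section. -/
theorem tra_eq (hZ : Z ≤ Subgroup.center G) (M : Type v) [CommGroup M]
    (μ : G ⧸ Z → G) (hμ : ∀ x, (μ x : G ⧸ Z) = x) (χ : Z →* M) :
    tra Z hZ M χ = cls (traCocycle Z hZ M μ hμ χ) :=
  cls_traCocycle_eq Z hZ M _ μ _ hμ χ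

end Transgression

section TwistedAlgebra

variable {R : Type v} [CommRing R] {G : Type u} [Group G]

/-- The twisted group ring `R^α G`: the free `R`-module on the basis `ḡ`, `g ∈ G` (here
`Finsupp.single g 1`), with multiplication `ḡ h̄ = α(g, h) (gh)‾`, extended bilinearly. -/
def TwistedGroupAlgebra (_α : Z2 G Rˣ) : Type (max u v) := G →₀ R

namespace TwistedGroupAlgebra

variable (α : Z2 G Rˣ)

instance : AddCommGroup (TwistedGroupAlgebra α) := inferInstanceAs (AddCommGroup (G →₀ R))

instance : Module R (TwistedGroupAlgebra α) := inferInstanceAs (Module R (G →₀ R))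

/-- The element `r ḡ` of `R^α G`. -/
def of (g : G) (r : R) : TwistedGroupAlgebra α := Finsupp.single g r

/-- The bilinear extension to `G →₀ R` of `(ḡ, h̄) ↦ α(g, h) (gh)‾`. -/
def mulHom (α : G × G → Rˣ) : (G →₀ R) →ₗ[R] (G →₀ R) →ₗ[R] (G →₀ R) :=
  Finsupp.lsum R fun g => LinearMap.toSpanSingleton R ((G →₀ R) →ₗ[R] (G →₀ R))
    (Finsupp.lsum R fun h => LinearMap.toSpanSingleton R (G →₀ R)
      (Finsupp.single (g * h) (α (g, h) : R)))

theorem mulHom_single (α : G × G → Rˣ) (g h : G) (r s : R) :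
    mulHom α (Finsupp.single g r) (Finsupp.single h s) =
      Finsupp.single (g * h) (r * s * (α (g, h) : R)) := by
  simp only [mulHom, Finsupp.lsum_single, LinearMap.toSpanSingleton_apply, LinearMap.smul_apply,
    Finsupp.smul_single', mul_assoc]

/-- The multiplication of `R^α G`. -/
instance : Mul (TwistedGroupAlgebra α) := ⟨fun a b => mulHom α.1 a b⟩

/-- The identity of `R^α G` is `α(1, 1)⁻¹ 1̄`. -/
instance : One (TwistedGroupAlgebra α) := ⟨of α 1 (((α.1 (1, 1))⁻¹ : Rˣ) : R)⟩

theorem one_def : (1 : TwistedGroupAlgebra α) = of α 1 (((α.1 (1, 1))⁻¹ : Rˣ) : R) := rfl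

theorem smul_of (r s : R) (g : G) : r • of α g s = of α g (r * s) := Finsupp.smul_single' r g s

/-- `r ḡ · s h̄ = r s α(g, h) (gh)‾`. -/
theorem of_mul_of (g h : G) (r s : R) :
    of α g r * of α h s = of α (g * h) (r * s * (α.1 (g, h) : R)) :=
  mulHom_single α.1 g h r s

theorem add_mul_aux (a b c : TwistedGroupAlgebra α) : (a + b) * c = a * c + b * c :=
  (mulHom α.1).map_add₂ a b c

theorem mul_add_aux (a b c : TwistedGroupAlgebra α) : a * (b + c) = a * b + a * c :=
  map_add (mulHom α.1 a) b c

theorem zero_mul_aux (a : TwistedGroupAlgebra α) : 0 * a = 0 :=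
  (mulHom α.1).map_zero₂ a

theorem mul_zero_aux (a : TwistedGroupAlgebra α) : a * 0 = 0 :=
  map_zero (mulHom α.1 a)

theorem smul_mul_aux (r : R) (a b : TwistedGroupAlgebra α) : (r • a) * b = r • (a * b) :=
  (mulHom α.1).map_smul₂ r a b

theorem mul_smul_aux (r : R) (a b : TwistedGroupAlgebra α) : a * (r • b) = r • (a * b) :=
  map_smul (mulHom α.1 a) r b

theorem induction_on {p : TwistedGroupAlgebra α → Prop} (a : TwistedGroupAlgebra α)
    (h0 : p 0) (hadd : ∀ a b, p a → p b → p (a + b)) (hof : ∀ g r, p (of α g r)) : p a :=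
  Finsupp.induction_linear (motive := p) a h0 hadd hof

theorem cocycle_one_left (g : G) : α.1 (1, g) = α.1 (1, 1) := by
  have := α.2 1 1 g
  simpa using this.symm

theorem cocycle_one_right (g : G) : α.1 (g, 1) = α.1 (1, 1) := by
  have := α.2 g 1 1
  simpa using this

instance : Ring (TwistedGroupAlgebra α) :=
  { (inferInstance : AddCommGroup (TwistedGroupAlgebra α)),
    (inferInstance : Mul (TwistedGroupAlgebra α)),
    (inferInstance : One (TwistedGroupAlgebra α)) with
    left_distrib := mul_add_aux α
    right_distrib := add_mul_aux α
    zero_mul := zero_mul_aux α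
    mul_zero := mul_zero_aux α
    mul_assoc := fun a b c => by
      induction a using induction_on with
      | h0 => simp only [zero_mul_aux]
      | hadd a a' h h' => simp only [add_mul_aux]; rw [h, h']
      | hof g r =>
      induction b using induction_on with
      | h0 => simp only [zero_mul_aux, mul_zero_aux]
      | hadd a a' h h' => simp only [add_mul_aux, mul_add_aux]; rw [h, h']
      | hof h s =>
      induction c using induction_on with
      | h0 => simp only [mul_zero_aux]
      | hadd a a' h h' => simp only [mul_add_aux]; rw [h, h']
      | hof k t =>
      have hα := congrArg (Units.val (α := R)) (α.2 g h k)
      simp only [Units.val_mul] at hα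
      simp only [of_mul_of, mul_assoc g]
      congr 1
      linear_combination (r * s * t) * hα
    one_mul := fun a => by
      induction a using induction_on with
      | h0 => simp only [mul_zero_aux]
      | hadd a a' h h' => simp only [mul_add_aux]; rw [h, h']
      | hof g r =>
      rw [one_def, of_mul_of, one_mul, cocycle_one_left α g, mul_right_comm, Units.inv_mul, one_mul]
    mul_one := fun a => by
      induction a using induction_on with
      | h0 => simp only [zero_mul_aux]
      | hadd a a' h h' => simp only [add_mul_aux]; rw [h, h']
      | hof g r =>
      rw [one_def, of_mul_of, mul_one, cocycle_one_right α g, mul_assoc, Units.inv_mul, mul_one] }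

instance : Algebra R (TwistedGroupAlgebra α) :=
  Algebra.ofModule (smul_mul_aux α) (mul_smul_aux α)

/-- The `R`-linear map `ḡ ↦ f(g) ḡ`. -/
def rescale (α β : Z2 G Rˣ) (f : G → Rˣ) :
    TwistedGroupAlgebra α →ₗ[R] TwistedGroupAlgebra β :=
  (Finsupp.lsum R fun g => LinearMap.toSpanSingleton R (G →₀ R) (Finsupp.single g (f g : R)) :
    (G →₀ R) →ₗ[R] (G →₀ R))

theorem rescale_of (α β : Z2 G Rˣ) (f : G → Rˣ) (g : G) (r : R) :
    rescale α β f (of α g r) = of β g (r * f g) := by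
  change (Finsupp.lsum R fun g => LinearMap.toSpanSingleton R (G →₀ R) (Finsupp.single g (f g : R)))
    (Finsupp.single g r) = Finsupp.single g (r * f g)
  rw [Finsupp.lsum_single, LinearMap.toSpanSingleton_apply, Finsupp.smul_single']

theorem rescale_rescale (α β : Z2 G Rˣ) (f : G → Rˣ) (a : TwistedGroupAlgebra α) :
    rescale β α f⁻¹ (rescale α β f a) = a := by
  induction a using induction_on with
  | h0 => simp only [map_zero]
  | hadd a b ha hb => simp only [map_add, ha, hb]
  | hof g r => simp only [rescale_of, Pi.inv_apply, Units.mul_inv_cancel_right]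

/-- The isomorphism type of `R^α G` depends only on the class of `α`. -/
theorem nonempty_algEquiv_of_cls_eq (α β : Z2 G Rˣ) (h : cls α = cls β) :
    Nonempty (TwistedGroupAlgebra α ≃ₐ[R] TwistedGroupAlgebra β) := by
  obtain ⟨f, hf⟩ := (cls_eq_cls_iff β α).1 h.symm
  refine ⟨AlgEquiv.ofLinearEquiv (LinearEquiv.ofLinearMap (rescale α β f) (rescale β α f⁻¹)
    (LinearMap.ext fun a => ?_) (LinearMap.ext fun a => rescale_rescale α β f a)) ?_ ?_⟩
  · simpa using rescale_rescale β α f⁻¹ a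
  · rw [LinearEquiv.coe_ofLinearMap, one_def, rescale_of, one_def]
    congr 1
    rw [← Units.val_mul, hf]
    congr 1
    simp
  · intro a b
    simp only [LinearEquiv.coe_ofLinearMap]
    induction a using induction_on with
    | h0 => simp only [zero_mul, map_zero]
    | hadd a a' h h' => simp only [add_mul, map_add, h, h']
    | hof g r =>
    induction b using induction_on with
    | h0 => simp only [mul_zero, map_zero]
    | hadd a a' h h' => simp only [mul_add, map_add, h, h']
    | hof h s =>
    simp only [of_mul_of, rescale_of]
    congr 1
    have hα : (α.1 (g, h) : R) * f (g * h) = β.1 (g, h) * (f g * f h) := by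
      simp only [← Units.val_mul]
      rw [hf, mul_assoc, inv_mul_cancel_right]
    linear_combination (r * s) * hα

end TwistedGroupAlgebra

end TwistedAlgebra

/-- `G ∼_R H` via the isomorphism `φ : H²(G, Rˣ) → H²(H, Rˣ)`: the `R`-algebras `R^α G` and
`R^{φ(α)} H` are isomorphic for every class `[α]`. All representatives `α` of a class of `G` and
`β` of its image under `φ` are allowed; the isomorphism types depend only on the classes, by
`TwistedGroupAlgebra.nonempty_algEquiv_of_cls_eq`. -/
def TwistedRelVia (R : Type w) [CommRing R] (G : Type u) (H : Type v) [Group G] [Group H]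
    (φ : H2 G Rˣ ≃* H2 H Rˣ) : Prop :=
  ∀ (α : Z2 G Rˣ) (β : Z2 H Rˣ), φ (cls α) = cls β →
    Nonempty (TwistedGroupAlgebra α ≃ₐ[R] TwistedGroupAlgebra β)

/-- The relation `G ∼_R H`. -/
def TwistedRel (R : Type w) [CommRing R] (G : Type u) (H : Type v) [Group G] [Group H] : Prop :=
  ∃ φ : H2 G Rˣ ≃* H2 H Rˣ, TwistedRelVia R G H φ

/-- Exactness of `1 → Hom(Z, M) → H²(G/Z, M) → H²(G, M) → 1`, where the maps are transgression and
inflation for the central subgroup `Z` of `G`. -/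
def TraInfExact {G : Type u} [Group G] (Z : Subgroup G) [Z.Normal]
    (hZ : Z ≤ Subgroup.center G) (M : Type v) [CommGroup M] : Prop :=
  Function.Injective (tra Z hZ M) ∧ (tra Z hZ M).range = (inf Z M).ker ∧
    Function.Surjective (inf Z M)

end TGR

end

noncomputable section

namespace TGR

open TwistedGroupAlgebra

universe u v w

/-! The engine is a decomposition for a central subgroup `Z` of a finite group `G`: the algebra
ℂ^{inf α}G is isomorphic to the product, over all characters χ of `Z`, of the algebras ℂ^{α·tra
χ}(G/Z) (`nonempty_algEquiv_pi`).

Exactness makes every class of G₁ an inflation and identifies ker inf with im tra. Since φ̄ carries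
im tra₁ onto im tra₂, it descends to an isomorphism φ of the groups H²(Gⱼ, ℂˣ). The factor of ℂ^{inf
a}G₁ at χ belongs to the class [a]·tra₁ χ, which φ̄ sends to φ̄[a]·tra₂(ī χ), the class of the
factor at ī χ on the other side. The factors are thus isomorphic in pairs, and so are the products.
-/

/-- The character table of a finite abelian group is nonsingular. -/
theorem eq_zero_of_forall_sum_char_mul_eq_zero {A : Type u} [CommGroup A] [Fintype A] (a : A → ℂ)
    (h : ∀ χ : A →* ℂˣ, ∑ z, (χ z : ℂ) * a z = 0) : a = 0 := by
  classical
  -- The non-canonical isomorphism of `A` with its dual only indexes the characters by `A`, which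
  -- makes the table a square matrix. Its rows are independent because distinct characters are.
  obtain ⟨e⟩ := CommGroup.monoidHom_mulEquiv_of_hasEnoughRootsOfUnity A ℂ
  let T : Matrix A A ℂ := fun y z => (e.symm y z : ℂ)
  have hli : LinearIndependent ℂ T.row := by
    refine (linearIndependent_monoidHom A ℂ).comp
      (fun y => (Units.coeHom ℂ).comp (e.symm y)) fun y y' hy => e.symm.injective ?_
    ext z
    exact DFunLike.congr_fun hy z
  have hinj := Matrix.mulVec_injective_iff_isUnit.2 (Matrix.linearIndependent_rows_iff_isUnit.1 hli)
  exact hinj (by ext y; simpa [Matrix.mulVec, dotProduct] using h (e.symm y))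

theorem natCard_monoidHom_units_complex (A : Type u) [CommGroup A] [Finite A] :
    Nat.card (A →* ℂˣ) = Nat.card A := by
  obtain ⟨e⟩ := CommGroup.monoidHom_mulEquiv_of_hasEnoughRootsOfUnity A ℂ
  exact Nat.card_congr e.toEquiv

/-- The commutative group structure of a central subgroup. -/
abbrev centralCommGroup {G : Type u} [Group G] (Z : Subgroup G) (hZ : Z ≤ Subgroup.center G) :
    CommGroup Z :=
  { (inferInstance : Group Z) with
    mul_comm := fun a b => Subtype.ext (Subgroup.mem_center_iff.1 (hZ b.2) a) }

/-! ### Maps out of twisted group algebras, and their dimension -/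

section Basis

variable {R : Type v} [CommRing R] {G : Type u} [Group G]

namespace TwistedGroupAlgebra

/-- The `R`-linear extension of a map on basis elements. -/
def lift {N : Type w} [AddCommGroup N] [Module R N] (α : Z2 G Rˣ) (f : G → N) :
    TwistedGroupAlgebra α →ₗ[R] N :=
  (Finsupp.lsum R fun g => LinearMap.toSpanSingleton R N (f g) : (G →₀ R) →ₗ[R] N)

theorem lift_of {N : Type w} [AddCommGroup N] [Module R N] (α : Z2 G Rˣ) (f : G → N) (g : G)
    (r : R) : lift α f (of α g r) = r • f g := by
  change (Finsupp.lsum R fun g => LinearMap.toSpanSingleton R N (f g)) (Finsupp.single g r) = _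
  rw [Finsupp.lsum_single, LinearMap.toSpanSingleton_apply]

/-- An `R`-linear map which is multiplicative on the basis is an algebra homomorphism. -/
def liftAlgHom {A : Type w} [Ring A] [Algebra R A] (α : Z2 G Rˣ) (f : G → A)
    (h1 : f 1 = ((α.1 (1, 1) : Rˣ) : R) • (1 : A))
    (hmul : ∀ g h, f g * f h = ((α.1 (g, h) : Rˣ) : R) • f (g * h)) :
    TwistedGroupAlgebra α →ₐ[R] A :=
  AlgHom.ofLinearMap (lift α f)
    -- The identity is α(1,1)⁻¹ 1̄, hence the factor α(1,1) in `h1`.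
    (by rw [one_def, lift_of, h1, smul_smul, Units.inv_mul, one_smul])
    (fun a b => by
      induction a using induction_on with
      | h0 => simp only [zero_mul, map_zero]
      | hadd a a' h h' => simp only [add_mul, map_add, h, h']
      | hof g r =>
      induction b using induction_on with
      | h0 => simp only [mul_zero, map_zero]
      | hadd a a' h h' => simp only [mul_add, map_add, h, h']
      | hof h s =>
      rw [of_mul_of, lift_of, lift_of, lift_of, smul_mul_smul_comm, hmul, smul_smul])

theorem liftAlgHom_of {A : Type w} [Ring A] [Algebra R A] (α : Z2 G Rˣ) (f : G → A) (h1) (hmul)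
    (g : G) (r : R) : liftAlgHom α f h1 hmul (of α g r) = r • f g :=
  lift_of α f g r

/-- The coefficients of an element of `R^α G`. -/
def coeff (α : Z2 G Rˣ) : TwistedGroupAlgebra α ≃ₗ[R] (G →₀ R) :=
  LinearEquiv.refl R (G →₀ R)

theorem coeff_of (α : Z2 G Rˣ) (g : G) (r : R) : coeff α (of α g r) = Finsupp.single g r := rfl

instance [Finite G] (α : Z2 G Rˣ) : Module.Finite R (TwistedGroupAlgebra α) :=
  Module.Finite.equiv (coeff α).symm

instance (α : Z2 G Rˣ) : Module.Free R (TwistedGroupAlgebra α) :=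
  Module.Free.of_equiv (coeff α).symm

theorem finrank_eq [Nontrivial R] [Finite G] (α : Z2 G Rˣ) :
    Module.finrank R (TwistedGroupAlgebra α) = Nat.card G := by
  have := Fintype.ofFinite G
  rw [(coeff α).finrank_eq, Module.finrank_finsupp_self, Nat.card_eq_fintype_card]

end TwistedGroupAlgebra

end Basis

/-! ### Decomposition along a central subgroup -/

section Decomposition

variable {G : Type u} [Group G] (Z : Subgroup G) [Z.Normal]

/-- The cocycle `α_χ` computed with the canonical section `G/Z → G`. -/
abbrev outTraCocycle (hZ : Z ≤ Subgroup.center G) (M : Type v) [CommGroup M] :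
    (Z →* M) →* Z2 (G ⧸ Z) M :=
  traCocycle Z hZ M Quotient.out fun x => QuotientGroup.out_eq' x

/-- The `Z`-part `g μ(gZ)⁻¹` of `g`, where `μ` is the canonical section. -/
def centralPart (g : G) : Z :=
  ⟨g * ((g : G ⧸ Z).out)⁻¹, by
    rw [← QuotientGroup.eq_one_iff, QuotientGroup.mk_mul, QuotientGroup.mk_inv,
      QuotientGroup.out_eq', mul_inv_cancel]⟩

/-- Write g = z_g μ(gZ). As z_h is central, gh = z_g z_h μ(gZ) μ(hZ), and the factor set rewrites
μ(gZ) μ(hZ) as a multiple of μ(ghZ). This is what makes `charProj` multiplicative. -/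
theorem centralPart_mul (hZ : Z ≤ Subgroup.center G) (g h : G) :
    centralPart Z g * centralPart Z h *
      factorSet Z Quotient.out (fun x => QuotientGroup.out_eq' x) (g : G ⧸ Z) (h : G ⧸ Z) =
      centralPart Z (g * h) := by
  apply Subtype.ext
  have hh := Subgroup.mem_center_iff.1 (hZ (centralPart Z h).2) (g : G ⧸ Z).out
  simp only [centralPart, factorSet, Subgroup.coe_mul, QuotientGroup.mk_mul] at hh ⊢
  generalize (g : G ⧸ Z).out = a at *
  generalize (h : G ⧸ Z).out = b at *
  generalize ((g : G ⧸ Z) * (h : G ⧸ Z)).out = c at *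
  calc g * a⁻¹ * (h * b⁻¹) * (a * b * c⁻¹) = g * a⁻¹ * ((h * b⁻¹) * a) * b * c⁻¹ := by group
    _ = _ := by rw [← hh]; group

theorem mk_mul_out (z : Z) (x : G ⧸ Z) : (((z : G) * x.out : G) : G ⧸ Z) = x := by
  rw [QuotientGroup.mk_mul, QuotientGroup.out_eq', (QuotientGroup.eq_one_iff (z : G)).2 z.2,
    one_mul]

theorem centralPart_mul_out (z : Z) (x : G ⧸ Z) : centralPart Z ((z : G) * x.out) = z := by
  apply Subtype.ext
  simp only [centralPart, mk_mul_out, mul_inv_cancel_right]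

theorem centralPart_mul_out_mk (g : G) : (centralPart Z g : G) * (g : G ⧸ Z).out = g := by
  simp [centralPart]

/-- `G` is in bijection with `Z × G/Z`. -/
def prodQuotientEquiv : Z × (G ⧸ Z) ≃ G where
  toFun p := p.1 * p.2.out
  invFun g := (centralPart Z g, g)
  left_inv p := Prod.ext (centralPart_mul_out Z p.1 p.2) (mk_mul_out Z p.1 p.2)
  right_inv g := centralPart_mul_out_mk Z g

variable {R : Type v} [CommRing R] (hZ : Z ≤ Subgroup.center G)

/-- The projection `R^{inf α} G → R^{α · α_χ} (G/Z)` attached to a character `χ` of `Z`. -/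
def charProj (α : Z2 (G ⧸ Z) Rˣ) (χ : Z →* Rˣ) :
    TwistedGroupAlgebra (infCocycle Z Rˣ α) →ₐ[R]
      TwistedGroupAlgebra (α * outTraCocycle Z hZ Rˣ χ) :=
  liftAlgHom _ (fun g => of _ (g : G ⧸ Z) (χ (centralPart Z g) : R))
    (by
      -- At g = h = 1 the factor-set identity says that χ(z₁) is inverse to the α_χ-part of the
      -- twist at (1, 1).
      have h := congrArg χ (centralPart_mul Z hZ 1 1)
      rw [map_mul, map_mul, mul_one, mul_assoc, mul_eq_left] at h
      rw [one_def, smul_of]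
      change of _ _ _ = of _ 1 (((α.1 (1, 1) : Rˣ) : R) *
        ((α.1 (1, 1) * χ (factorSet Z _ _ ((1 : G) : G ⧸ Z) ((1 : G) : G ⧸ Z)))⁻¹ : Rˣ))
      rw [← Units.val_mul, mul_inv, mul_inv_cancel_left, eq_inv_of_mul_eq_one_left h,
        QuotientGroup.mk_one])
    (fun g h => by
      have hc := congrArg (fun z => ((χ z : Rˣ) : R)) (centralPart_mul Z hZ g h)
      simp only [map_mul, Units.val_mul] at hc
      rw [of_mul_of, smul_of, ← hc]
      change of _ _ (_ * ((α.1 (g, h) * χ (factorSet Z _ _ _ _) : Rˣ) : R)) =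
        of _ _ ((α.1 (g, h) : R) * _)
      congr 1
      rw [Units.val_mul]
      ring)

theorem charProj_of (α : Z2 (G ⧸ Z) Rˣ) (χ : Z →* Rˣ) (g : G) (r : R) :
    charProj Z hZ α χ (of _ g r) = of _ (g : G ⧸ Z) (r * χ (centralPart Z g)) := by
  rw [charProj, liftAlgHom_of, smul_of]

/-- The coset x consists of the elements z μ(x), and each of them maps to χ(z) x̄. Projecting is
therefore a Fourier transform along the cosets of `Z`. -/
theorem coeff_charProj [Fintype Z] (α : Z2 (G ⧸ Z) Rˣ) (χ : Z →* Rˣ)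
    (a : TwistedGroupAlgebra (infCocycle Z Rˣ α)) (x : G ⧸ Z) :
    coeff _ (charProj Z hZ α χ a) x = ∑ z : Z, (χ z : R) * coeff _ a ((z : G) * x.out) := by
  classical
  induction a using induction_on with
  | h0 => simp
  | hadd a b ha hb =>
    simp only [map_add, Finsupp.add_apply, ha, hb, mul_add, Finset.sum_add_distrib]
  | hof g r =>
    rw [charProj_of, coeff_of, coeff_of, Finsupp.single_apply]
    simp only [Finsupp.single_apply]
    split_ifs with h
    · subst h
      rw [Finset.sum_eq_single (centralPart Z g)]
      · rw [if_pos (centralPart_mul_out_mk Z g).symm, mul_comm]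
      · intro z _ hz
        rw [if_neg, mul_zero]
        intro hg
        exact hz ((centralPart_mul_out Z z g).symm.trans (congrArg _ hg.symm))
      · simp
    · refine (Finset.sum_eq_zero fun z _ => ?_).symm
      rw [if_neg, mul_zero]
      rintro rfl
      exact h (mk_mul_out Z z x)

/-- If all projections of an element vanish, nonsingularity of the character table of `Z` kills its
coefficients on each coset. Surjectivity is then a dimension count: |Hom(Z, ℂˣ)|·|G/Z| = |Z|·|G/Z| =
|G|. -/
theorem nonempty_algEquiv_pi [Finite G] (α : Z2 (G ⧸ Z) ℂˣ) :
    Nonempty (TwistedGroupAlgebra (infCocycle Z ℂˣ α) ≃ₐ[ℂ]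
      ∀ χ : Z →* ℂˣ, TwistedGroupAlgebra (α * outTraCocycle Z hZ ℂˣ χ)) := by
  have := Fintype.ofFinite Z
  let _ := centralCommGroup Z hZ
  have hcard : Nat.card (Z →* ℂˣ) = Nat.card Z := natCard_monoidHom_units_complex Z
  -- `Nat.card` is 0 on infinite types, so a nonzero value forces finiteness.
  have : Finite (Z →* ℂˣ) := Nat.finite_of_card_ne_zero (hcard ▸ Nat.card_pos.ne')
  have := Fintype.ofFinite (Z →* ℂˣ)
  let F := AlgHom.pi (charProj Z hZ α)
  refine ⟨AlgEquiv.ofBijective F ?_⟩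
  have hinj : Function.Injective F := by
    refine (injective_iff_map_eq_zero F).2 fun a ha => ?_
    apply (coeff _).injective
    ext g
    have := eq_zero_of_forall_sum_char_mul_eq_zero
      (fun z : Z => coeff _ a ((z : G) * (g : G ⧸ Z).out)) fun χ => by
        have := coeff_charProj Z hZ α χ a g
        rw [← this, show charProj Z hZ α χ a = 0 from congrFun ha χ, map_zero, Finsupp.zero_apply]
    simpa [centralPart_mul_out_mk] using congrFun this (centralPart Z g)
  have hrank : Module.finrank ℂ (TwistedGroupAlgebra (infCocycle Z ℂˣ α)) = Module.finrank ℂ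
      (∀ χ : Z →* ℂˣ, TwistedGroupAlgebra (α * outTraCocycle Z hZ ℂˣ χ)) := by
    rw [Module.finrank_pi_fintype]
    simp only [finrank_eq, Finset.sum_const, Finset.card_univ, smul_eq_mul]
    rw [← Nat.card_eq_fintype_card, hcard, ← Nat.card_prod, Nat.card_congr (prodQuotientEquiv Z)]
  exact ⟨hinj, (LinearMap.injective_iff_surjective_of_finrank_eq_finrank
    (f := F.toLinearMap) hrank).1 hinj⟩

end Decomposition

end TGR

end

/-! ### Descent of φ̄ and matching of the factors -/

theorem theorem1p1 {G₁ : Type*} {G₂ : Type*} [Group G₁] [Group G₂] [Finite G₁] [Finite G₂]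
    (Z₁ : Subgroup G₁) (Z₂ : Subgroup G₂) [Z₁.Normal] [Z₂.Normal]
    (hZ₁ : Z₁ ≤ Subgroup.center G₁) (hZ₂ : Z₂ ≤ Subgroup.center G₂)
    (hex₁ : TGR.TraInfExact Z₁ hZ₁ ℂˣ) (hex₂ : TGR.TraInfExact Z₂ hZ₂ ℂˣ)
    (φbar : TGR.H2 (G₁ ⧸ Z₁) ℂˣ ≃* TGR.H2 (G₂ ⧸ Z₂) ℂˣ)
    (hφ : TGR.TwistedRelVia ℂ (G₁ ⧸ Z₁) (G₂ ⧸ Z₂) φbar)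
    (ibar : (Z₁ →* ℂˣ) ≃* (Z₂ →* ℂˣ))
    (hcomm : ∀ χ : Z₁ →* ℂˣ, φbar (TGR.tra Z₁ hZ₁ ℂˣ χ) = TGR.tra Z₂ hZ₂ ℂˣ (ibar χ)) :
    TGR.TwistedRel ℂ G₁ G₂ := by
  have hker : (TGR.inf Z₁ ℂˣ).ker.map φbar.toMonoidHom = (TGR.inf Z₂ ℂˣ).ker := by
    rw [← hex₁.2.1, ← hex₂.2.1]
    ext y
    constructor
    · rintro ⟨_, ⟨χ, rfl⟩, rfl⟩
      exact ⟨ibar χ, (hcomm χ).symm⟩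
    · rintro ⟨χ, rfl⟩
      refine ⟨_, ⟨ibar.symm χ, rfl⟩, ?_⟩
      simpa using hcomm (ibar.symm χ)
  let e₁ := QuotientGroup.quotientKerEquivOfSurjective _ hex₁.2.2
  let e₂ := QuotientGroup.quotientKerEquivOfSurjective _ hex₂.2.2
  -- H²(Gⱼ, ℂˣ) is the quotient of H²(Gⱼ/Zⱼ, ℂˣ) by ker inf, so φ̄ induces φ.
  let φ := (e₁.symm.trans (QuotientGroup.congr _ _ φbar hker)).trans e₂
  have hφinf : ∀ a, φ (TGR.inf Z₁ ℂˣ a) = TGR.inf Z₂ ℂˣ (φbar a) := by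
    intro a
    have : e₁.symm (TGR.inf Z₁ ℂˣ a) = (a : _ ⧸ (TGR.inf Z₁ ℂˣ).ker) :=
      e₁.symm_apply_eq.2 rfl
    simp only [φ, MulEquiv.trans_apply, this]
    rfl
  refine ⟨φ, fun α β hαβ => ?_⟩
  obtain ⟨a, ha⟩ := hex₁.2.2 (TGR.cls α)
  obtain ⟨a, rfl⟩ := QuotientGroup.mk'_surjective _ a
  obtain ⟨b, hb⟩ := QuotientGroup.mk'_surjective _ (φbar (TGR.cls a))
  change TGR.cls b = _ at hb
  have hα : TGR.cls α = TGR.cls (TGR.infCocycle Z₁ ℂˣ a) := ha.symm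
  have hβ : TGR.cls (TGR.infCocycle Z₂ ℂˣ b) = TGR.cls β := by
    rw [← hαβ, ← ha]
    refine Eq.trans ?_ (hφinf (TGR.cls a)).symm
    rw [← hb]
    rfl
  obtain ⟨E₀⟩ := TGR.TwistedGroupAlgebra.nonempty_algEquiv_of_cls_eq _ _ hα
  obtain ⟨E₁⟩ := TGR.nonempty_algEquiv_pi Z₁ hZ₁ a
  obtain ⟨E₂⟩ := TGR.nonempty_algEquiv_pi Z₂ hZ₂ b
  obtain ⟨E₃⟩ := TGR.TwistedGroupAlgebra.nonempty_algEquiv_of_cls_eq _ _ hβ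
  have hP : ∀ χ, Nonempty
      (TGR.TwistedGroupAlgebra (a * TGR.outTraCocycle Z₁ hZ₁ ℂˣ χ) ≃ₐ[ℂ]
        TGR.TwistedGroupAlgebra (b * TGR.outTraCocycle Z₂ hZ₂ ℂˣ (ibar χ))) := fun χ =>
    hφ _ _ (by
      rw [map_mul, map_mul, map_mul, hb]
      exact congrArg _ (hcomm χ))
  let P := AlgEquiv.piCongrRight fun χ => (hP χ).some
  -- The product reached by `P` is indexed by χ through ī χ; reindexing along ī gives the product
  -- over all characters of Z₂.
  let Q := AlgEquiv.piCongrLeft ℂ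
    (fun χ => TGR.TwistedGroupAlgebra (b * TGR.outTraCocycle Z₂ hZ₂ ℂˣ χ)) ibar.toEquiv
  exact ⟨E₀.trans (E₁.trans (P.trans (Q.trans (E₂.symm.trans E₃))))⟩
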